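/- Let $\mathcal D$ be a small category, $X:\mathcal D^{op}\to \mathrm{Set}$ a presheaf of sets, $\mathcal D\downarrow X$ the comma category of the Yoneda embedding $h^{\mathcal D}$ over $X$ (objects: pairs $(a, h^{\mathcal D}_a\to X)$, equivalently pairs $(a, z)$ with $z\in X(a)$), and $Q_X:\mathcal D\downarrow X\to\mathcal D$ the forgetful functor. For a small category $\mathcal C$ and a functor $G:\mathcal C\to \mathrm{Grp}$, let $C_*(\mathcal C,G)$ be the simplicial group with $C_n(\mathcal C,G)=\ast_{c_0\to\cdots\to c_n}G(c_0)$ (free product over all chains of $n$ composable morphisms of $\mathcal C$), whose face and degeneracy homomorphisms act on the chains as in the nerve of $\mathcal C$ and leave $x\in G(c_0)$ unchanged, except that $d_0(c_0\xrightarrow{\alpha_1}c_1\to\cdots\to c_n,\,x)=(c_1\to\cdots\to c_n,\,G(\alpha_1)(x))$. Put $\operatorname{colim}^{\mathcal C}_nG:=\pi_n(C_*(\mathcal C,G))$ for $n\ge 0$. For a group diagram $G:(\mathcal D\downarrow X)^{op}\to\mathrm{Grp}$ put $$H_n(X,G):=\operatorname{colim}^{\mathcal D^{op}}_n \mathrm{Lan}^{Q_X^{op}}G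 ,$$ where $\mathrm{Lan}^{Q_X^{op}}$ is the left Kan extension along $Q_X^{op}$. Then: (1) For every $n\ge 0$ there is an isomorphism, natural in $G$, $$\operatorname{colim}^{(\mathcal D\downarrow X)^{op}}_n G\;\cong\; H_n(X,G);$$ it is the canonical homomorphism, i.e. the one induced by the unit $G\to(\mathrm{Lan}^{Q_X^{op}}G)\circ Q_X^{op}$ followed by the homomorphism $\operatorname{colim}^{(\mathcal D\downarrow X)^{op}}_n\big((\mathrm{Lan}^{Q_X^{op}}G)\circ Q_X^{op}\big)\to\operatorname{colim}^{\mathcal D^{op}}_n\mathrm{Lan}^{Q_X^{op}}G$ given on chains by $(s,x)\mapsto(Q_X^{op}\circ s,\,x)$. (2) For every $G$, the functor $\mathrm{Lan}^{Q_X^{op}}G:\mathcal D^{op}\to\mathrm{Grp}$ is isomorphic to the functor which sends an object $a$ to the free product $\ast_{z\in X(a)}G(z)$ and a morphism $\alpha:b\to a$ of $\mathcal D$ to the homomorphism $$\ast_{z\in X(a)}G(z)\to \ast_{z\in X(b)}G(z),\qquad (z\in X(a),\,g\in G(z))\mapsto\big(X(\alpha)(z),\;G(z\xrightarrow{\alpha}X(\alpha)(z))(g)\big),$$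 by an isomorphism under which the unit at $z\in X(a)$ becomes the inclusion of the free factor $G(z)$. -/

import Mathlib

open CategoryTheory CategoryTheory.Limits Opposite Simplicial

universe u

namespace GroupDiagram

/-! ### Homotopy groups of simplicial groups -/

section HomotopyGroups

/-- The Moore cycles `⋂ᵢ ker (dᵢ : Kₙ → Kₙ₋₁)` of a simplicial group `K`
(all of `K₀` in degree `0`). -/
def mooreCycles (K : SimplicialObject GrpCat.{u}) (n : ℕ) : Subgroup (K _⦋n⦌) :=
  match n with
  | 0 => ⊤
  | n + 1 => ⨅ i : Fin (n + 2), (K.δ i).hom.ker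

/-- The Moore boundaries: the image under `d₀` of those elements of `Kₙ₊₁` which are killed by
the faces `d₁, …, dₙ₊₁`. -/
def mooreBoundaries (K : SimplicialObject GrpCat.{u}) (n : ℕ) : Subgroup (K _⦋n⦌) :=
  (⨅ i : Fin (n + 1), (K.δ i.succ).hom.ker).map (K.δ (0 : Fin (n + 2))).hom

instance mooreBoundaries_normal (K : SimplicialObject GrpCat.{u}) (n : ℕ) :
    (mooreBoundaries K n).Normal := by
  constructor
  rintro _ ⟨z, hz, rfl⟩ g
  refine ⟨(K.σ (0 : Fin (n + 1))).hom g * z * ((K.σ (0 : Fin (n + 1))).hom g)⁻¹, ?_, ?_⟩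
  · simp only [SetLike.mem_coe, Subgroup.mem_iInf, MonoidHom.mem_ker] at hz ⊢
    intro i
    simp [hz i]
  · have h : (K.δ (0 : Fin (n + 2))).hom ((K.σ (0 : Fin (n + 1))).hom g) = g := by
      have := K.δ_comp_σ_self (i := (0 : Fin (n + 1)))
      exact congrArg (fun f => f.hom g) this
    simp [h]

/-- The `n`-th homotopy group of a simplicial group: Moore cycles modulo Moore boundaries. -/
abbrev homotopyGroup (K : SimplicialObject GrpCat.{u}) (n : ℕ) : Type u :=
  mooreCycles K n ⧸ (mooreBoundaries K n).subgroupOf (mooreCycles K n)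

theorem naturality_δ {K L : SimplicialObject GrpCat.{u}} (f : K ⟶ L) {n : ℕ} (i : Fin (n + 2))
    (x : K _⦋n + 1⦌) :
    (L.δ i).hom ((f.app (op ⦋n + 1⦌)).hom x) = (f.app (op ⦋n⦌)).hom ((K.δ i).hom x) :=
  (congrArg (fun g => g.hom x) (SimplicialObject.δ_naturality f i)).symm

theorem map_mem_mooreCycles {K L : SimplicialObject GrpCat.{u}} (f : K ⟶ L) {n : ℕ}
    {x : K _⦋n⦌} (hx : x ∈ mooreCycles K n) :
    (f.app (op ⦋n⦌)).hom x ∈ mooreCycles L n := by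
  cases n with
  | zero => exact Subgroup.mem_top _
  | succ n =>
    simp only [mooreCycles, Subgroup.mem_iInf, MonoidHom.mem_ker] at hx ⊢
    intro i
    rw [naturality_δ, hx i, map_one]

theorem map_mem_mooreBoundaries {K L : SimplicialObject GrpCat.{u}} (f : K ⟶ L) {n : ℕ}
    {x : K _⦋n⦌} (hx : x ∈ mooreBoundaries K n) :
    (f.app (op ⦋n⦌)).hom x ∈ mooreBoundaries L n := by
  obtain ⟨z, hz, rfl⟩ := hx
  refine ⟨(f.app (op ⦋n + 1⦌)).hom z, ?_, naturality_δ f 0 z⟩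
  simp only [SetLike.mem_coe, Subgroup.mem_iInf, MonoidHom.mem_ker] at hz ⊢
  intro i
  rw [naturality_δ, hz i, map_one]

/-- The homomorphism induced by a simplicial homomorphism on Moore cycles. -/
def mooreCyclesMap {K L : SimplicialObject GrpCat.{u}} (f : K ⟶ L) (n : ℕ) :
    mooreCycles K n →* mooreCycles L n :=
  ((f.app (op ⦋n⦌)).hom.comp (mooreCycles K n).subtype).codRestrict (mooreCycles L n)
    fun x => map_mem_mooreCycles f x.2

/-- The homomorphism induced by a simplicial homomorphism on homotopy groups. -/
def homotopyGroupMap {K L : SimplicialObject GrpCat.{u}} (f : K ⟶ L) (n : ℕ) :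
    homotopyGroup K n →* homotopyGroup L n :=
  QuotientGroup.map _ _ (mooreCyclesMap f n) fun _ hx => map_mem_mooreBoundaries f hx

/-- The functor `πₙ` from simplicial groups to groups. -/
def homotopyGroupFunctor (n : ℕ) : SimplicialObject GrpCat.{u} ⥤ GrpCat.{u} where
  obj K := GrpCat.of (homotopyGroup K n)
  map f := GrpCat.ofHom (homotopyGroupMap f n)
  map_id K := by
    ext x
    rfl
  map_comp f g := by
    ext x
    rfl

end HomotopyGroups

/-! ### Non-abelian homology of group diagrams -/

section Homology

variable {C : Type u} [SmallCategory C]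

/-- The free product of the groups `G(c₀)` over all chains `c₀ → ⋯ → cₙ`, `Δ = [n]`. -/
abbrev chainGroup (G : C ⥤ GrpCat.{u}) (Δ : SimplexCategoryᵒᵖ) : Type u :=
  Monoid.CoprodI fun s : ComposableArrows C Δ.unop.len => G.obj (s.obj 0)

/-- The inclusion `x ↦ (s, x)` of the free factor of a chain `s`. -/
def chainOf (G : C ⥤ GrpCat.{u}) {Δ : SimplexCategoryᵒᵖ} (s : ComposableArrows C Δ.unop.len) :
    G.obj (s.obj 0) →* chainGroup G Δ :=
  Monoid.CoprodI.of (M := fun s : ComposableArrows C Δ.unop.len => G.obj (s.obj 0)) (i := s)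

/-- The action of a simplicial operator on the chains of `C`, as in the nerve of `C`. -/
abbrev chainPull {Δ Δ' : SimplexCategoryᵒᵖ} (θ : Δ ⟶ Δ') (s : ComposableArrows C Δ.unop.len) :
    ComposableArrows C Δ'.unop.len :=
  s.whiskerLeft (SimplexCategory.toCat.map θ.unop).toFunctor

/-- The arrow `s(0) → s(θ(0))` from the initial object of a chain to that of its pull-back. -/
def chainArrow {Δ Δ' : SimplexCategoryᵒᵖ} (θ : Δ ⟶ Δ') (s : ComposableArrows C Δ.unop.len) :
    s.obj 0 ⟶ (chainPull θ s).obj 0 :=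
  s.map (homOfLE (Fin.zero_le (θ.unop.toOrderHom 0)))

theorem chainArrow_id {Δ : SimplexCategoryᵒᵖ} (s : ComposableArrows C Δ.unop.len) :
    chainArrow (𝟙 Δ) s = 𝟙 (s.obj 0) :=
  s.map_id 0

theorem chainArrow_comp {Δ Δ' Δ'' : SimplexCategoryᵒᵖ} (θ : Δ ⟶ Δ') (θ' : Δ' ⟶ Δ'')
    (s : ComposableArrows C Δ.unop.len) :
    chainArrow (θ ≫ θ') s = chainArrow θ s ≫ chainArrow θ' (chainPull θ s) :=
  s.map_comp (homOfLE (Fin.zero_le (θ.unop.toOrderHom 0)))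
    (homOfLE (θ.unop.toOrderHom.monotone (Fin.zero_le (θ'.unop.toOrderHom 0))))

theorem chainArrow_naturality {Δ Δ' : SimplexCategoryᵒᵖ} (θ : Δ ⟶ Δ') {G G' : C ⥤ GrpCat.{u}}
    (φ : G ⟶ G') (s : ComposableArrows C Δ.unop.len) (x : G.obj (s.obj 0)) :
    (φ.app ((chainPull θ s).obj 0)).hom ((G.map (chainArrow θ s)).hom x) =
      (G'.map (chainArrow θ s)).hom ((φ.app (s.obj 0)).hom x) :=
  congrArg (fun g => g.hom x) (φ.naturality (chainArrow θ s))

/-- The action of a simplicial operator `θ : [m] → [n]`: it sends `(s, x)` to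
`(s ∘ θ, G(s(0) → s(θ(0)))(x))`. For a face `dᵢ` with `i > 0` or a degeneracy, `θ(0) = 0` and `x`
is unchanged; for the face `d₀`, the map `s(0) → s(1)` is the first arrow of the chain. -/
def chainMap (G : C ⥤ GrpCat.{u}) {Δ Δ' : SimplexCategoryᵒᵖ} (θ : Δ ⟶ Δ') :
    chainGroup G Δ →* chainGroup G Δ' :=
  Monoid.CoprodI.lift fun s =>
    (chainOf G (chainPull θ s)).comp
      (G.map (chainArrow θ s)).hom

theorem chainMap_of (G : C ⥤ GrpCat.{u}) {Δ Δ' : SimplexCategoryᵒᵖ} (θ : Δ ⟶ Δ')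
    (s : ComposableArrows C Δ.unop.len) (x : G.obj (s.obj 0)) :
    chainMap G θ (chainOf G s x) =
      chainOf G (chainPull θ s)
        ((G.map (chainArrow θ s)).hom x) :=
  Monoid.CoprodI.lift_of _ _

/-- The simplicial replacement `C_*(C, G)` of a group diagram. -/
def simplicialReplacement (G : C ⥤ GrpCat.{u}) : SimplicialObject GrpCat.{u} where
  obj Δ := GrpCat.of (chainGroup G Δ)
  map θ := GrpCat.ofHom (chainMap G θ)
  map_id Δ := by
    apply GrpCat.hom_ext
    apply Monoid.CoprodI.ext_hom
    intro s
    ext x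
    change chainMap G (𝟙 Δ) (chainOf G s x) = chainOf G s x
    refine (chainMap_of G (𝟙 Δ) s x).trans ?_
    have h : G.map (chainArrow (𝟙 Δ) s) = 𝟙 _ := (congrArg G.map (chainArrow_id s)).trans (G.map_id _)
    exact congrArg (chainOf G s) (congrArg (fun g => g.hom x) h)
  map_comp θ θ' := by
    apply GrpCat.hom_ext
    apply Monoid.CoprodI.ext_hom
    intro s
    ext x
    change chainMap G (θ ≫ θ') (chainOf G s x) = chainMap G θ' (chainMap G θ (chainOf G s x))
    refine (chainMap_of G (θ ≫ θ') s x).trans ?_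
    refine Eq.symm ((congrArg (chainMap G θ') (chainMap_of G θ s x)).trans ?_)
    refine (chainMap_of G θ' (chainPull θ s) _).trans ?_
    have h : G.map (chainArrow (θ ≫ θ') s) =
        G.map (chainArrow θ s) ≫ G.map (chainArrow θ' (chainPull θ s)) :=
      (congrArg G.map (chainArrow_comp θ θ' s)).trans (G.map_comp _ _)
    exact congrArg (chainOf G (chainPull (θ ≫ θ') s)) (congrArg (fun g => g.hom x) h).symm

/-- The homomorphism `(s, x) ↦ (s, φ(x))` induced by a morphism `φ` of group diagrams. -/
def chainGroupMap {G G' : C ⥤ GrpCat.{u}} (φ : G ⟶ G') (Δ : SimplexCategoryᵒᵖ) :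
    chainGroup G Δ →* chainGroup G' Δ :=
  Monoid.CoprodI.lift fun s => (chainOf G' s).comp (φ.app (s.obj 0)).hom

theorem chainGroupMap_of {G G' : C ⥤ GrpCat.{u}} (φ : G ⟶ G') {Δ : SimplexCategoryᵒᵖ}
    (s : ComposableArrows C Δ.unop.len) (x : G.obj (s.obj 0)) :
    chainGroupMap φ Δ (chainOf G s x) = chainOf G' s ((φ.app (s.obj 0)).hom x) :=
  Monoid.CoprodI.lift_of _ _

/-- The simplicial replacement as a functor of the group diagram. -/
def simplicialReplacementFunctor (C : Type u) [SmallCategory C] :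
    (C ⥤ GrpCat.{u}) ⥤ SimplicialObject GrpCat.{u} where
  obj G := simplicialReplacement G
  map {G G'} φ :=
    { app Δ := GrpCat.ofHom (chainGroupMap φ Δ)
      naturality Δ Δ' θ := by
        apply GrpCat.hom_ext
        apply Monoid.CoprodI.ext_hom
        intro s
        ext x
        refine (congrArg (chainGroupMap φ Δ') (chainMap_of G θ s x)).trans ?_
        refine (chainGroupMap_of φ (chainPull θ s) _).trans ?_
        refine Eq.symm ((congrArg (chainMap G' θ) (chainGroupMap_of φ s x)).trans ?_)
        refine (chainMap_of G' θ s _).trans ?_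
        exact congrArg (chainOf G' (chainPull θ s)) (chainArrow_naturality θ φ s x).symm }
  map_id G := by
    ext Δ : 2
    apply Monoid.CoprodI.ext_hom
    intro s
    ext x
    exact chainGroupMap_of (𝟙 G) s x
  map_comp φ ψ := by
    ext Δ : 2
    apply Monoid.CoprodI.ext_hom
    intro s
    ext x
    refine (chainGroupMap_of (φ ≫ ψ) s x).trans ?_
    refine Eq.symm ((congrArg (chainGroupMap ψ Δ) (chainGroupMap_of φ s x)).trans ?_)
    exact chainGroupMap_of ψ s _

/-- The non-abelian homology functors `colimₙ^C : Grp^C ⥤ Grp`, the homotopy groups of the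
simplicial replacement. -/
def colimN (C : Type u) [SmallCategory C] (n : ℕ) : (C ⥤ GrpCat.{u}) ⥤ GrpCat.{u} :=
  simplicialReplacementFunctor C ⋙ homotopyGroupFunctor n

/-- For `S : C ⥤ D` and a group diagram `G` on `D`, the homomorphism `(s, x) ↦ (S ∘ s, x)` from
the free product over the chains of `C` to that over the chains of `D`. -/
def chainPush {D : Type u} [SmallCategory D] (S : C ⥤ D) (G : D ⥤ GrpCat.{u})
    (Δ : SimplexCategoryᵒᵖ) : chainGroup (S ⋙ G) Δ →* chainGroup G Δ :=
  Monoid.CoprodI.lift fun s => chainOf G (Δ := Δ) (s ⋙ S)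

theorem chainPush_of {D : Type u} [SmallCategory D] (S : C ⥤ D) (G : D ⥤ GrpCat.{u})
    {Δ : SimplexCategoryᵒᵖ} (s : ComposableArrows C Δ.unop.len) (x : (S ⋙ G).obj (s.obj 0)) :
    chainPush S G Δ (chainOf (S ⋙ G) s x) = chainOf G (Δ := Δ) (s ⋙ S) x :=
  Monoid.CoprodI.lift_of _ _

/-- The simplicial homomorphism `C_*(C, G ∘ S) → C_*(D, G)`, `(s, x) ↦ (S ∘ s, x)`. -/
def simplicialReplacementPush {D : Type u} [SmallCategory D] (S : C ⥤ D) (G : D ⥤ GrpCat.{u}) :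
    simplicialReplacement (S ⋙ G) ⟶ simplicialReplacement G where
  app Δ := GrpCat.ofHom (chainPush S G Δ)
  naturality Δ Δ' θ := by
    apply GrpCat.hom_ext
    apply Monoid.CoprodI.ext_hom
    intro s
    ext x
    refine (congrArg (chainPush S G Δ') (chainMap_of (S ⋙ G) θ s x)).trans ?_
    refine (chainPush_of S G (chainPull θ s) _).trans ?_
    refine Eq.symm ((congrArg (chainMap G θ) (chainPush_of S G s x)).trans ?_)
    exact chainMap_of G (Δ := Δ) θ (s ⋙ S) x

/-- The canonical homomorphism `colimₙ^C (G ∘ S) → colimₙ^D G`. -/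
def colimNPush {D : Type u} [SmallCategory D] (S : C ⥤ D) (G : D ⥤ GrpCat.{u}) (n : ℕ) :
    (colimN C n).obj (S ⋙ G) ⟶ (colimN D n).obj G :=
  (homotopyGroupFunctor n).map (simplicialReplacementPush S G)

end Homology

/-! ### Colimits of groups -/

section Colimits

variable {J : Type u} [SmallCategory J] (F : J ⥤ GrpCat.{u})

/-- The relations identifying `x ∈ F(i)` with `F(f)(x) ∈ F(j)` in the free product. -/
def colimitRels : Set (Monoid.CoprodI fun j => F.obj j) :=
  { w | ∃ (i j : J) (f : i ⟶ j) (x : F.obj i),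
      w = (Monoid.CoprodI.of (M := fun j => F.obj j) (i := i) x)⁻¹ *
        Monoid.CoprodI.of (M := fun j => F.obj j) (i := j) ((F.map f).hom x) }

/-- The colimit cocone of a small diagram of groups. -/
def colimitCocone : Cocone F where
  pt := GrpCat.of ((Monoid.CoprodI fun j => F.obj j) ⧸ Subgroup.normalClosure (colimitRels F))
  ι :=
    { app j := GrpCat.ofHom ((QuotientGroup.mk' _).comp
        (Monoid.CoprodI.of (M := fun j => F.obj j) (i := j)))
      naturality i j f := by
        ext x
        exact (QuotientGroup.eq.2 (Subgroup.subset_normalClosure (s := colimitRels F)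
          (show _ ∈ colimitRels F from ⟨i, j, f, x, rfl⟩))).symm }

/-- The cocone `colimitCocone F` is a colimit. -/
def colimitCoconeIsColimit : IsColimit (colimitCocone F) where
  desc s := GrpCat.ofHom (QuotientGroup.lift _ (Monoid.CoprodI.lift fun j => (s.ι.app j).hom)
    (by
      apply Subgroup.normalClosure_le_normal
      rintro _ ⟨i, j, f, x, rfl⟩
      have h : (s.ι.app j).hom ((F.map f).hom x) = (s.ι.app i).hom x :=
        congrArg (fun g => g.hom x) (s.w f)
      simp [MonoidHom.mem_ker, h]))
  fac s j := by
    ext x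
    exact Monoid.CoprodI.lift_of _ _
  uniq s m hm := by
    apply GrpCat.hom_ext
    apply QuotientGroup.monoidHom_ext
    apply Monoid.CoprodI.ext_hom
    intro j
    ext x
    refine (congrArg (fun g => g.hom x) (hm j)).trans ?_
    exact (Monoid.CoprodI.lift_of _ _).symm

instance hasColimits_grpCat : HasColimitsOfSize.{u, u} GrpCat.{u} where
  has_colimits_of_shape _ _ :=
    { has_colimit := fun F => HasColimit.mk
        { cocone := colimitCocone F, isColimit := colimitCoconeIsColimit F } }

end Colimits

/-! ### Homology of presheaves with coefficients in group diagrams -/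

section Presheaves

variable {D : Type u} [SmallCategory D] (X : Dᵒᵖ ⥤ Type u)

/-- The forgetful functor `Q_X^op : (D ↓ X)^op ⥤ D^op`, where `D ↓ X` is the comma category of the
Yoneda embedding over `X`. -/
abbrev forgetOp : (CostructuredArrow yoneda X)ᵒᵖ ⥤ Dᵒᵖ :=
  (CostructuredArrow.proj yoneda X).op

/-- The non-abelian homology functor
`H_n(X, -) = colimₙ^{D^op} ∘ Lan^{Q_X^op} : Grp^{(D ↓ X)^op} ⥤ Grp`. -/
noncomputable def presheafHomology (n : ℕ) :
    ((CostructuredArrow yoneda X)ᵒᵖ ⥤ GrpCat.{u}) ⥤ GrpCat.{u} :=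
  (forgetOp X).lan ⋙ colimN Dᵒᵖ n

/-- The canonical homomorphism `colimₙ^{(D ↓ X)^op} G → colimₙ^{D^op} (Lan^{Q_X^op} G)`: the unit
`G → (Lan G) ∘ Q_X^op` followed by the homomorphism induced by `Q_X^op`. -/
noncomputable def canonicalHom (n : ℕ) (G : (CostructuredArrow yoneda X)ᵒᵖ ⥤ GrpCat.{u}) :
    (colimN (CostructuredArrow yoneda X)ᵒᵖ n).obj G ⟶ (presheafHomology X n).obj G :=
  (colimN (CostructuredArrow yoneda X)ᵒᵖ n).map ((forgetOp X).lanUnit.app G) ≫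
    colimNPush (forgetOp X) ((forgetOp X).lan.obj G) n

variable {X}

/-- The object of `(D ↓ X)^op` given by an element `z ∈ X(a)` (by the Yoneda lemma). -/
abbrev elt {a : Dᵒᵖ} (z : X.obj a) : (CostructuredArrow yoneda X)ᵒᵖ :=
  op (CostructuredArrow.mk (Y := a.unop) (yonedaEquiv.symm z))

/-- The morphism `z → X(α)(z)` of `(D ↓ X)^op` given by `z ∈ X(a)` and a morphism `α : b → a`
of `D`. -/
def eltMap {a b : Dᵒᵖ} (α : a ⟶ b) (z : X.obj a) : elt z ⟶ elt (X.map α z) :=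
  Quiver.Hom.op (CostructuredArrow.homMk α.unop (yonedaEquiv_symm_map α z).symm)

/-- The free product of the groups `G(z)` over the elements `z ∈ X(a)`. -/
abbrev eltGroup (G : (CostructuredArrow yoneda X)ᵒᵖ ⥤ GrpCat.{u}) (a : Dᵒᵖ) : Type u :=
  Monoid.CoprodI fun z : X.obj a => G.obj (elt z)

/-- The inclusion `g ↦ (z, g)` of the free factor of `z ∈ X(a)`. -/
def eltOf (G : (CostructuredArrow yoneda X)ᵒᵖ ⥤ GrpCat.{u}) {a : Dᵒᵖ} (z : X.obj a) :
    G.obj (elt z) →* eltGroup G a :=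
  Monoid.CoprodI.of (M := fun z : X.obj a => G.obj (elt z)) (i := z)

/-- The homomorphism `(z, g) ↦ (X(α)(z), G(z → X(α)(z))(g))` given by a morphism `α : b → a`
of `D`. -/
def eltGroupMap (G : (CostructuredArrow yoneda X)ᵒᵖ ⥤ GrpCat.{u}) {a b : Dᵒᵖ} (α : a ⟶ b) :
    eltGroup G a →* eltGroup G b :=
  Monoid.CoprodI.lift fun z => (eltOf G (X.map α z)).comp (G.map (eltMap α z)).hom

theorem eltGroupMap_of (G : (CostructuredArrow yoneda X)ᵒᵖ ⥤ GrpCat.{u}) {a b : Dᵒᵖ} (α : a ⟶ b)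
    (z : X.obj a) (g : G.obj (elt z)) :
    eltGroupMap G α (eltOf G z g) = eltOf G (X.map α z) ((G.map (eltMap α z)).hom g) :=
  Monoid.CoprodI.lift_of _ _

theorem eltOf_map_congr (G : (CostructuredArrow yoneda X)ᵒᵖ ⥤ GrpCat.{u}) {a : Dᵒᵖ}
    {c : (CostructuredArrow yoneda X)ᵒᵖ} {z z' : X.obj a} (h : z = z')
    (f : c ⟶ elt z) (f' : c ⟶ elt z') (hf : f.unop.left = f'.unop.left) (g : G.obj c) :
    eltOf G z ((G.map f).hom g) = eltOf G z' ((G.map f').hom g) := by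
  subst h
  have : f = f' := Quiver.Hom.unop_inj (CostructuredArrow.hom_ext _ _ hf)
  rw [this]

/-- The presheaf of groups `a ↦ ⋆_{z ∈ X(a)} G(z)`. -/
def freeProductPresheaf (G : (CostructuredArrow yoneda X)ᵒᵖ ⥤ GrpCat.{u}) : Dᵒᵖ ⥤ GrpCat.{u} where
  obj a := GrpCat.of (eltGroup G a)
  map α := GrpCat.ofHom (eltGroupMap G α)
  map_id a := by
    apply GrpCat.hom_ext
    apply Monoid.CoprodI.ext_hom
    intro z
    ext g
    refine (eltGroupMap_of G (𝟙 a) z g).trans ?_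
    refine (eltOf_map_congr G (by simp) (eltMap (𝟙 a) z) (𝟙 (elt z)) rfl g).trans ?_
    rw [G.map_id]
    rfl
  map_comp {a b c} α β := by
    apply GrpCat.hom_ext
    apply Monoid.CoprodI.ext_hom
    intro z
    ext g
    refine (eltGroupMap_of G (α ≫ β) z g).trans ?_
    refine (eltOf_map_congr G (by simp) (eltMap (α ≫ β) z)
      (eltMap α z ≫ eltMap β (X.map α z)) rfl g).trans ?_
    rw [G.map_comp]
    refine Eq.symm ((congrArg (eltGroupMap G β) (eltGroupMap_of G α z g)).trans ?_)
    exact eltGroupMap_of G β _ _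

end Presheaves

end GroupDiagram

namespace GroupDiagram

/-! ### Naturality of the push-forward of chains -/

section Push

variable {C D : Type u} [SmallCategory C] [SmallCategory D]

/-! The functor `forgetOp X` is the projection of the category of elements of `X`, a discrete
opfibration: a morphism `a ⟶ b` of `Dᵒᵖ` and an element `z` over `a` have exactly one lift starting
at `z`. This gives both claims.

The left Kan extension is the coproduct over each fibre, and coproducts of groups are free products.
Here this is checked directly from the universal property
(`freeProductPresheaf_isLeftKanExtension`).

A chain of `(D ↓ X)ᵒᵖ` is the same as a chain `t` of `Dᵒᵖ` with an element of `X(t(0))`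
(`liftChain_toElement`). So the free product over all `t` of the free products over `X(t(0))` is the
free product over the chains upstairs, and the two simplicial groups are already isomorphic before
homotopy groups are taken (`simplicialReplacementProj_isIso`). As the isomorphism of Kan extensions
respects the units, this map is the canonical one (`canonicalHom_comp_lanIsoFreeProduct`). -/

theorem simplicialReplacementPush_naturality (S : C ⥤ D) {G G' : D ⥤ GrpCat.{u}} (φ : G ⟶ G') :
    (simplicialReplacementFunctor C).map (S.whiskerLeft φ) ≫ simplicialReplacementPush S G' =
      simplicialReplacementPush S G ≫ (simplicialReplacementFunctor D).map φ := by
  ext Δ : 2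
  apply Monoid.CoprodI.ext_hom
  intro s
  ext x
  refine (congrArg (chainPush S G' Δ) (chainGroupMap_of (S.whiskerLeft φ) s x)).trans ?_
  refine (chainPush_of S G' s _).trans ?_
  refine Eq.symm ((congrArg (chainGroupMap φ Δ) (chainPush_of S G s x)).trans ?_)
  exact chainGroupMap_of φ (Δ := Δ) (s ⋙ S) x

theorem colimNPush_naturality (S : C ⥤ D) {G G' : D ⥤ GrpCat.{u}} (φ : G ⟶ G') (n : ℕ) :
    (colimN C n).map (S.whiskerLeft φ) ≫ colimNPush S G' n =
      colimNPush S G n ≫ (colimN D n).map φ := by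
  refine ((homotopyGroupFunctor n).map_comp _ _).symm.trans ?_
  refine (congrArg (homotopyGroupFunctor n).map (simplicialReplacementPush_naturality S φ)).trans ?_
  exact (homotopyGroupFunctor n).map_comp _ _

/-- A change of coefficients after the push-forward can be absorbed into the unit `η`. This serves
both for naturality in the diagram and for replacing the Kan extension by the free products. -/
theorem colimN_map_comp_push (S : C ⥤ D) {F : C ⥤ GrpCat.{u}} {G G' : D ⥤ GrpCat.{u}}
    (η : F ⟶ S ⋙ G) (φ : G ⟶ G') (n : ℕ) :
    ((colimN C n).map η ≫ colimNPush S G n) ≫ (colimN D n).map φ =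
      (colimN C n).map (η ≫ S.whiskerLeft φ) ≫ colimNPush S G' n := by
  refine (Category.assoc _ _ _).trans ?_
  refine (congrArg ((colimN C n).map η ≫ ·) (colimNPush_naturality S φ n).symm).trans ?_
  refine (Category.assoc _ _ _).symm.trans ?_
  exact congrArg (· ≫ colimNPush S G' n) ((colimN C n).map_comp _ _).symm

theorem groupDiagram_map_id (G : C ⥤ GrpCat.{u}) (c : C) (x : G.obj c) :
    (G.map (𝟙 c)).hom x = x :=
  congrArg (fun k => k.hom x) (G.map_id c)

theorem groupDiagram_map_comp (G : C ⥤ GrpCat.{u}) {c c' c'' : C} (f : c ⟶ c') (g : c' ⟶ c'')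
    (x : G.obj c) : (G.map (f ≫ g)).hom x = (G.map g).hom ((G.map f).hom x) :=
  congrArg (fun k => k.hom x) (G.map_comp f g)

end Push

/-! ### The left Kan extension along `Q_X^op` -/

section KanExtension

variable {D : Type u} [SmallCategory D] {X : Dᵒᵖ ⥤ Type u}

/-- The element of the presheaf which corresponds to an object of `(D ↓ X)^op`. -/
def toElement (c : (CostructuredArrow yoneda X)ᵒᵖ) : X.obj ((forgetOp X).obj c) :=
  yonedaEquiv c.unop.hom

/-- The canonical morphism from an object of `(D ↓ X)^op` to that of its element. -/
def toElt (c : (CostructuredArrow yoneda X)ᵒᵖ) : c ⟶ elt (toElement c) :=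
  Quiver.Hom.op (CostructuredArrow.homMk (𝟙 c.unop.left) (by
    change yoneda.map (𝟙 c.unop.left) ≫ c.unop.hom = yonedaEquiv.symm (yonedaEquiv c.unop.hom)
    rw [Equiv.symm_apply_apply, CategoryTheory.Functor.map_id]
    exact Category.id_comp _))

theorem toElement_elt {a : Dᵒᵖ} (z : X.obj a) : toElement (elt z) = z :=
  yonedaEquiv.apply_symm_apply z

theorem map_toElement {c c' : (CostructuredArrow yoneda X)ᵒᵖ} (f : c ⟶ c') :
    X.map ((forgetOp X).map f) (toElement c) = toElement c' := by
  refine (yonedaEquiv_naturality' (F := X) c.unop.hom ((forgetOp X).map f)).trans ?_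
  exact congrArg yonedaEquiv (CostructuredArrow.w f.unop)

variable (G : (CostructuredArrow yoneda X)ᵒᵖ ⥤ GrpCat.{u})

/-- The homomorphism `G(c) → ⋆_{z ∈ X(a)} G(z)` onto the free factor of the element of `c`. -/
def eltUnitHom (c : (CostructuredArrow yoneda X)ᵒᵖ) :
    G.obj c →* eltGroup G ((forgetOp X).obj c) :=
  (eltOf G (toElement c)).comp (G.map (toElt c)).hom

/-- The inclusions of the free factors, as a morphism of group diagrams on `(D ↓ X)^op`. -/
def eltUnit : G ⟶ forgetOp X ⋙ freeProductPresheaf G where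
  app c := GrpCat.ofHom (eltUnitHom G c)
  naturality c c' f := by
    ext x
    change eltOf G (toElement c') ((G.map (toElt c')).hom ((G.map f).hom x)) =
      eltGroupMap G ((forgetOp X).map f) (eltOf G (toElement c) ((G.map (toElt c)).hom x))
    refine Eq.symm ((eltGroupMap_of G ((forgetOp X).map f) (toElement c) _).trans ?_)
    -- The two targets belong to elements that are only propositionally equal, but both composites
    -- have `f.unop.left` as underlying arrow of `D`.
    have h := eltOf_map_congr G (map_toElement f)
      (toElt c ≫ eltMap ((forgetOp X).map f) (toElement c)) (f ≫ toElt c')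
      (by
        change f.unop.left ≫ 𝟙 _ = 𝟙 _ ≫ f.unop.left
        simp) x
    rw [G.map_comp, G.map_comp] at h
    exact h

theorem eltUnit_elt {a : Dᵒᵖ} (z : X.obj a) (g : G.obj (elt z)) :
    ((eltUnit G).app (elt z)).hom g = eltOf G z g := by
  refine (eltOf_map_congr G (toElement_elt z) (toElt (elt z)) (𝟙 (elt z)) rfl g).trans ?_
  exact congrArg (eltOf G z) (groupDiagram_map_id G (elt z) g)

variable {G}

/-- The morphism out of the free products given by a morphism out of `G`. -/
def freeProductDesc {F : Dᵒᵖ ⥤ GrpCat.{u}} (β : G ⟶ forgetOp X ⋙ F) :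
    freeProductPresheaf G ⟶ F where
  app a := GrpCat.ofHom (Monoid.CoprodI.lift (M := fun z : X.obj a => G.obj (elt z))
    (N := F.obj a) fun z => (β.app (elt z)).hom)
  naturality a b α := by
    apply GrpCat.hom_ext
    apply Monoid.CoprodI.ext_hom
    intro z
    ext g
    refine (congrArg (Monoid.CoprodI.lift (M := fun z : X.obj b => G.obj (elt z))
      (N := F.obj b) fun z => (β.app (elt z)).hom)
      (eltGroupMap_of G α z g)).trans ?_
    refine (Monoid.CoprodI.lift_of _ _).trans ?_
    refine (congrArg (fun k => k.hom g) (β.naturality (eltMap α z))).trans ?_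
    exact (congrArg (F.map α).hom (Monoid.CoprodI.lift_of _ _)).symm

theorem freeProductDesc_eltOf {F : Dᵒᵖ ⥤ GrpCat.{u}} (β : G ⟶ forgetOp X ⋙ F) {a : Dᵒᵖ}
    (z : X.obj a) (g : G.obj (elt z)) :
    ((freeProductDesc β).app a).hom (eltOf G z g) = (β.app (elt z)).hom g :=
  Monoid.CoprodI.lift_of _ _

/-- Naturality of `β` at `toElt c` suffices, since `toElt c` projects to an identity of `Dᵒᵖ`. -/
theorem eltUnit_freeProductDesc {F : Dᵒᵖ ⥤ GrpCat.{u}} (β : G ⟶ forgetOp X ⋙ F) :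
    eltUnit G ≫ (forgetOp X).whiskerLeft (freeProductDesc β) = β := by
  ext c x
  refine (freeProductDesc_eltOf β (toElement c) ((G.map (toElt c)).hom x)).trans ?_
  refine (congrArg (fun k => k.hom x) (β.naturality (toElt c))).trans ?_
  exact congrArg (fun k => k.hom ((β.app c).hom x)) (F.map_id _)

/-- The free factors generate, and by `eltUnit_elt` each inclusion is a component of `eltUnit G`. -/
theorem freeProductPresheaf_hom_ext {F : Dᵒᵖ ⥤ GrpCat.{u}} {φ ψ : freeProductPresheaf G ⟶ F}
    (h : eltUnit G ≫ (forgetOp X).whiskerLeft φ = eltUnit G ≫ (forgetOp X).whiskerLeft ψ) :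
    φ = ψ := by
  ext a : 2
  apply GrpCat.hom_ext
  apply Monoid.CoprodI.ext_hom
  intro z
  ext g
  have h' : (φ.app a).hom (((eltUnit G).app (elt z)).hom g) =
      (ψ.app a).hom (((eltUnit G).app (elt z)).hom g) :=
    congrArg (fun k => (k.app (elt z)).hom g) h
  rw [eltUnit_elt] at h'
  exact h'

instance freeProductPresheaf_isLeftKanExtension :
    (freeProductPresheaf G).IsLeftKanExtension (eltUnit G) where
  nonempty_isUniversal := ⟨IsInitial.ofUniqueHom
    (fun E => StructuredArrow.homMk (freeProductDesc E.hom) (eltUnit_freeProductDesc E.hom))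
    (fun E m => StructuredArrow.hom_ext _ _ (freeProductPresheaf_hom_ext
      ((StructuredArrow.w m).trans (eltUnit_freeProductDesc E.hom).symm)))⟩

variable (G)

/-- The left Kan extension along `Q_X^op` is given by the free products over the elements. -/
noncomputable def lanIsoFreeProduct : (forgetOp X).lan.obj G ≅ freeProductPresheaf G :=
  Functor.leftKanExtensionUnique _ ((forgetOp X).lanUnit.app G) _ (eltUnit G)

/-- Compatibility with the units is what identifies the canonical homomorphism itself, beyond an
abstract isomorphism. -/
theorem lanUnit_lanIsoFreeProduct :
    (forgetOp X).lanUnit.app G ≫ (forgetOp X).whiskerLeft (lanIsoFreeProduct G).hom =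
      eltUnit G :=
  (Functor.descOfIsLeftKanExtension_fac _ ((forgetOp X).lanUnit.app G) _ _).trans
    (Category.id_comp _)

end KanExtension

/-! ### Lifting chains along `Q_X^op` -/

section Lift

variable {D : Type u} [SmallCategory D] {X : Dᵒᵖ ⥤ Type u}

/-- The chain of `(D ↓ X)^op` over a chain `t` of `D^op` which starts at `z ∈ X(t(0))`. -/
def liftChain {n : ℕ} (t : ComposableArrows Dᵒᵖ n) (z : X.obj (t.obj 0)) :
    ComposableArrows (CostructuredArrow yoneda X)ᵒᵖ n where
  obj i := elt (X.map (t.map (homOfLE (Fin.zero_le i))) z)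
  map {i j} f := Quiver.Hom.op (CostructuredArrow.homMk (t.map f).unop (by
    -- Functoriality of `t` makes `X(t(f))` carry the element at `i` to the element at `j`.
    have h : t.map (homOfLE (Fin.zero_le j)) = t.map (homOfLE (Fin.zero_le i)) ≫ t.map f :=
      t.map_comp (homOfLE (Fin.zero_le i)) f
    refine (yonedaEquiv_symm_map (t.map f) _).symm.trans (congrArg yonedaEquiv.symm ?_)
    rw [h]
    simp))
  map_id i := by
    apply Quiver.Hom.unop_inj
    apply CostructuredArrow.hom_ext
    exact congrArg Quiver.Hom.unop (t.map_id i)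
  map_comp f g := by
    apply Quiver.Hom.unop_inj
    apply CostructuredArrow.hom_ext
    exact congrArg Quiver.Hom.unop (t.map_comp f g)

/-- The canonical morphism from `z` to the initial object of its lifted chain. -/
def liftChainArrow {n : ℕ} (t : ComposableArrows Dᵒᵖ n) (z : X.obj (t.obj 0)) :
    elt z ⟶ (liftChain t z).obj 0 :=
  eltMap (t.map (homOfLE (Fin.zero_le 0))) z

theorem liftChainArrow_left {n : ℕ} (t : ComposableArrows Dᵒᵖ n) (z : X.obj (t.obj 0)) :
    (liftChainArrow t z).unop.left = 𝟙 (t.obj 0).unop :=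
  congrArg Quiver.Hom.unop (t.map_id 0)

/-- Equality of objects, not just an isomorphism, is needed because chains index the free factors.
-/
theorem elt_toElement (c : (CostructuredArrow yoneda X)ᵒᵖ) : elt (toElement c) = c := by
  obtain ⟨⟨a, ⟨⟨⟩⟩, f⟩⟩ := c
  exact congrArg (fun f : yoneda.obj a ⟶ X => op (CostructuredArrow.mk f))
    (yonedaEquiv.symm_apply_apply f)

/-- The projection is faithful, so equality on morphisms can be tested after applying it. -/
theorem eq_of_comp_forgetOp {J : Type*} [Category* J]
    {s s' : J ⥤ (CostructuredArrow yoneda X)ᵒᵖ} (h : ∀ j, s.obj j = s'.obj j)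
    (h' : s ⋙ forgetOp X = s' ⋙ forgetOp X) : s = s' := by
  refine CategoryTheory.Functor.ext h fun i j f => (forgetOp X).map_injective ?_
  rw [Functor.map_comp, Functor.map_comp, eqToHom_map, eqToHom_map]
  exact Functor.congr_hom h' f

/-- Uniqueness of lifts: the arrow from `s(0)` to `s(j)` forces the element at `j`, and the
projections agree by definition. -/
theorem liftChain_toElement {n : ℕ} (s : ComposableArrows (CostructuredArrow yoneda X)ᵒᵖ n) :
    liftChain (s ⋙ forgetOp X) (toElement (s.obj 0)) = s :=
  eq_of_comp_forgetOp
    (fun j => (congrArg elt (map_toElement (s.map (homOfLE (Fin.zero_le j))))).trans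
      (elt_toElement (s.obj j))) rfl

variable (G : (CostructuredArrow yoneda X)ᵒᵖ ⥤ GrpCat.{u})

/-- The arrows are compared by `HEq` because their endpoints in `D` coincide only after `h` is
substituted. -/
theorem chainOf_map_congr {Δ : SimplexCategoryᵒᵖ}
    {s s' : ComposableArrows (CostructuredArrow yoneda X)ᵒᵖ Δ.unop.len} (h : s = s')
    {c : (CostructuredArrow yoneda X)ᵒᵖ} (f : c ⟶ s.obj 0) (f' : c ⟶ s'.obj 0)
    (hf : HEq f.unop.left f'.unop.left) (x : G.obj c) :
    chainOf G s ((G.map f).hom x) = chainOf G s' ((G.map f').hom x) := by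
  subst h
  have : f = f' := Quiver.Hom.unop_inj (CostructuredArrow.hom_ext _ _ (eq_of_heq hf))
  rw [this]

/-- The homomorphism `(s, x) ↦ (Q_X^op ∘ s, (s(0), x))`. -/
def chainProj (Δ : SimplexCategoryᵒᵖ) : chainGroup G Δ →* chainGroup (freeProductPresheaf G) Δ :=
  (chainPush (forgetOp X) (freeProductPresheaf G) Δ).comp (chainGroupMap (eltUnit G) Δ)

theorem chainProj_of {Δ : SimplexCategoryᵒᵖ}
    (s : ComposableArrows (CostructuredArrow yoneda X)ᵒᵖ Δ.unop.len) (x : G.obj (s.obj 0)) :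
    chainProj G Δ (chainOf G s x) =
      chainOf (freeProductPresheaf G) (Δ := Δ) (s ⋙ forgetOp X)
        (eltOf G (toElement (s.obj 0)) ((G.map (toElt (s.obj 0))).hom x)) :=
  (congrArg (chainPush (forgetOp X) (freeProductPresheaf G) Δ)
    (chainGroupMap_of (eltUnit G) s x)).trans (chainPush_of (forgetOp X) _ s _)

/-- The homomorphism which sends `(t, (z, x))` to `x` on the chain over `t` starting at `z`. -/
def chainLift (Δ : SimplexCategoryᵒᵖ) : chainGroup (freeProductPresheaf G) Δ →* chainGroup G Δ :=
  Monoid.CoprodI.lift fun t => Monoid.CoprodI.lift fun z : X.obj (t.obj 0) =>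
    (chainOf G (liftChain t z)).comp (G.map (liftChainArrow t z)).hom

theorem chainLift_of {Δ : SimplexCategoryᵒᵖ} (t : ComposableArrows Dᵒᵖ Δ.unop.len)
    (z : X.obj (t.obj 0)) (x : G.obj (elt z)) :
    chainLift G Δ (chainOf (freeProductPresheaf G) t (eltOf G z x)) =
      chainOf G (liftChain t z) ((G.map (liftChainArrow t z)).hom x) :=
  (Monoid.CoprodI.lift_of _ _).trans (Monoid.CoprodI.lift_of _ _)

theorem chainLift_chainProj {Δ : SimplexCategoryᵒᵖ} (w : chainGroup G Δ) :
    chainLift G Δ (chainProj G Δ w) = w := by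
  suffices h : (chainLift G Δ).comp (chainProj G Δ) = MonoidHom.id _ from DFunLike.congr_fun h w
  apply Monoid.CoprodI.ext_hom
  intro s
  ext x
  refine (congrArg (chainLift G Δ) (chainProj_of G s x)).trans ?_
  refine (chainLift_of G (Δ := Δ) (s ⋙ forgetOp X) _ _).trans ?_
  -- The round trip acts on coefficients through a composite lying over an identity of `D`.
  have h := chainOf_map_congr G (Δ := Δ) (liftChain_toElement s)
    (toElt (s.obj 0) ≫ liftChainArrow (s ⋙ forgetOp X) (toElement (s.obj 0))) (𝟙 (s.obj 0))
    (heq_of_eq (by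
      refine (congrArg (· ≫ 𝟙 _) (liftChainArrow_left (s ⋙ forgetOp X) _)).trans ?_
      exact Category.comp_id _)) x
  refine Eq.trans ?_ (h.trans (congrArg (chainOf G s) (groupDiagram_map_id G _ x)))
  exact congrArg (chainOf G (Δ := Δ) _) (groupDiagram_map_comp G _ _ x).symm

theorem chainProj_chainLift {Δ : SimplexCategoryᵒᵖ} (w : chainGroup (freeProductPresheaf G) Δ) :
    chainProj G Δ (chainLift G Δ w) = w := by
  suffices h : (chainProj G Δ).comp (chainLift G Δ) = MonoidHom.id _ from DFunLike.congr_fun h w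
  apply Monoid.CoprodI.ext_hom
  intro t
  apply Monoid.CoprodI.ext_hom
  intro z
  ext x
  refine (congrArg (chainProj G Δ) (chainLift_of G t z x)).trans ?_
  refine (chainProj_of G (liftChain t z) _).trans ?_
  refine congrArg (chainOf (freeProductPresheaf G) t) ?_
  have hz : toElement ((liftChain t z).obj 0) = z := by
    refine (toElement_elt _).trans ?_
    have h : t.map (homOfLE (Fin.zero_le 0)) = 𝟙 _ := t.map_id 0
    rw [h]
    exact congrArg (fun k => k z) (X.map_id _)
  have h := eltOf_map_congr G (a := t.obj 0) hz
    (liftChainArrow t z ≫ toElt ((liftChain t z).obj 0)) (𝟙 (elt z))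
    (by
      refine (congrArg (𝟙 _ ≫ ·) (liftChainArrow_left t z)).trans ?_
      exact Category.comp_id _) x
  refine Eq.trans ?_ (h.trans (congrArg (eltOf G z) (groupDiagram_map_id G _ x)))
  exact congrArg (eltOf G (a := t.obj 0) _) (groupDiagram_map_comp G _ _ x).symm

instance simplicialReplacementProj_isIso :
    IsIso ((simplicialReplacementFunctor _).map (eltUnit G) ≫
      simplicialReplacementPush (forgetOp X) (freeProductPresheaf G)) := by
  -- Levelwise inverses suffice, so `chainLift` need not be shown to commute with the simplicial
  -- operators.
  rw [NatTrans.isIso_iff_isIso_app]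
  intro Δ
  refine ⟨⟨GrpCat.ofHom (chainLift G Δ), ?_, ?_⟩⟩
  · ext w
    exact chainLift_chainProj G w
  · ext w
    exact chainProj_chainLift G w

end Lift

/-! ### The canonical homomorphism -/

section Canonical

variable {D : Type u} [SmallCategory D] (X : Dᵒᵖ ⥤ Type u)

/-- After the push-forward is moved past the change of coefficients, only naturality of the Kan
extension unit remains. -/
theorem canonicalHom_naturality (n : ℕ) {G G' : (CostructuredArrow yoneda X)ᵒᵖ ⥤ GrpCat.{u}}
    (φ : G ⟶ G') :
    (colimN _ n).map φ ≫ canonicalHom X n G' =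
      canonicalHom X n G ≫ (presheafHomology X n).map φ := by
  refine Eq.trans ?_ (colimN_map_comp_push (forgetOp X) ((forgetOp X).lanUnit.app G)
    ((forgetOp X).lan.map φ) n).symm
  refine (Category.assoc _ _ _).symm.trans ?_
  refine congrArg (· ≫ colimNPush (forgetOp X) ((forgetOp X).lan.obj G') n) ?_
  refine ((colimN _ n).map_comp _ _).symm.trans ?_
  exact congrArg (colimN _ n).map ((forgetOp X).lanUnit.naturality φ)

theorem canonicalHom_comp_lanIsoFreeProduct (n : ℕ)
    (G : (CostructuredArrow yoneda X)ᵒᵖ ⥤ GrpCat.{u}) :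
    canonicalHom X n G ≫ (colimN Dᵒᵖ n).map (lanIsoFreeProduct G).hom =
      (homotopyGroupFunctor n).map ((simplicialReplacementFunctor _).map (eltUnit G) ≫
        simplicialReplacementPush (forgetOp X) (freeProductPresheaf G)) := by
  refine (colimN_map_comp_push (forgetOp X) ((forgetOp X).lanUnit.app G)
    (lanIsoFreeProduct G).hom n).trans ?_
  rw [lanUnit_lanIsoFreeProduct]
  exact ((homotopyGroupFunctor n).map_comp _ _).symm

instance canonicalHom_isIso (n : ℕ) (G : (CostructuredArrow yoneda X)ᵒᵖ ⥤ GrpCat.{u}) :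
    IsIso (canonicalHom X n G) := by
  have h : IsIso (canonicalHom X n G ≫ (colimN Dᵒᵖ n).map (lanIsoFreeProduct G).hom) := by
    rw [canonicalHom_comp_lanIsoFreeProduct]
    exact Functor.map_isIso (homotopyGroupFunctor n) _
  have h' : IsIso ((colimN Dᵒᵖ n).map (lanIsoFreeProduct G).hom) := Functor.map_isIso _ _
  -- Two out of three: the composite and its second factor are isomorphisms.
  exact @IsIso.of_isIso_comp_right _ _ _ _ _ _ _ h' h

/-- The canonical homomorphisms as a natural isomorphism. -/
noncomputable def canonicalIso (n : ℕ) :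
    colimN (CostructuredArrow yoneda X)ᵒᵖ n ≅ presheafHomology X n :=
  NatIso.ofComponents (fun G => asIso (canonicalHom X n G))
    fun φ => canonicalHom_naturality X n φ

end Canonical

end GroupDiagram

theorem mainTheorem5 {D : Type u} [SmallCategory D] (X : Dᵒᵖ ⥤ Type u) :
    (∀ n : ℕ, ∃ e : GroupDiagram.colimN (CostructuredArrow yoneda X)ᵒᵖ n ≅
        GroupDiagram.presheafHomology X n,
      ∀ G : (CostructuredArrow yoneda X)ᵒᵖ ⥤ GrpCat.{u},
        e.hom.app G = GroupDiagram.canonicalHom X n G) ∧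
    ∀ G : (CostructuredArrow yoneda X)ᵒᵖ ⥤ GrpCat.{u},
      ∃ e : (GroupDiagram.forgetOp X).lan.obj G ≅ GroupDiagram.freeProductPresheaf G,
        ∀ (a : Dᵒᵖ) (z : X.obj a) (g : G.obj (GroupDiagram.elt z)),
          (e.hom.app a).hom
              ((((GroupDiagram.forgetOp X).lanUnit.app G).app (GroupDiagram.elt z)).hom g) =
            GroupDiagram.eltOf G z g := by
  refine ⟨fun n => ⟨GroupDiagram.canonicalIso X n, fun _ => rfl⟩, fun G =>
    ⟨GroupDiagram.lanIsoFreeProduct G, fun a z g => ?_⟩⟩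
  refine Eq.trans ?_ (GroupDiagram.eltUnit_elt G z g)
  exact congrArg (fun φ => (φ.app (GroupDiagram.elt z)).hom g)
    (GroupDiagram.lanUnit_lanIsoFreeProduct G)
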